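/- Let $\Lambda=(\lambda_i)_{i=0}^\infty$ be a strictly increasing sequence of real numbers with $\lambda_0=0$ and $\sum_{i=1}^\infty 1/\lambda_i<\infty$, and let the Müntz space $M(\Lambda)$ be the closure of the linear span of the functions $t\mapsto t^{\lambda_i}$ ($i\ge 0$, with $t^{0}\equiv 1$) in the space $C[0,1]$ of real-valued continuous functions on $[0,1]$ with the supremum norm $\|\cdot\|_\infty$. Let $c$ be the Banach space of convergent real sequences with the supremum norm. Then $M(\Lambda)$ is the topological direct sum $X\oplus Y$ of two closed linear subspaces $X$ and $Y$ such that $X$ is finite dimensional and $Y$ is almost isometric to a subspace of $c$, that is, for every $\varepsilon>0$ there is a bounded linear operator $J:Y\to c$ with $$(1-\varepsilon)\|f\|_\infty\le\|Jf\|\le\|f\|_\infty\qquad\text{for all } f\in Y.$$ -/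

import Mathlib

open scoped NNReal BoundedContinuousFunction

namespace Muntz

/-- A Müntz sequence: a strictly increasing sequence `0 = l 0 < l 1 < l 2 < ⋯` of non-negative
real numbers with `∑_{i ≥ 1} 1 / l i < ∞`. -/
structure IsMuntzSequence (l : ℕ → ℝ≥0) : Prop where
  zero : l 0 = 0
  strictMono : StrictMono l
  summable : Summable fun i : ℕ => 1 / (l (i + 1) : ℝ)

/-- The function `t ↦ t ^ a` in `C[0,1]`, for a real exponent `a ≥ 0` (with `t ^ 0 = 1` for all
`t`, also at `t = 0`). -/
noncomputable def power (a : ℝ≥0) : C(unitInterval, ℝ) where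
  toFun t := (t : ℝ) ^ (a : ℝ)
  continuous_toFun :=
    continuous_subtype_val.rpow_const fun _ => Or.inr a.coe_nonneg

/-- `M(l)`: the closed linear span of the functions `t ↦ t ^ (l i)`, `i = 0, 1, 2, …`, in `C[0,1]`
with the supremum norm. -/
noncomputable def muntzSpace (l : ℕ → ℝ≥0) : Submodule ℝ C(unitInterval, ℝ) :=
  (Submodule.span ℝ (Set.range fun i : ℕ => power (l i))).topologicalClosure

/-- The space `c` of convergent real sequences with the supremum norm, as a subspace of the space
of all bounded real sequences. -/
noncomputable def convergentSeq : Submodule ℝ (ℕ →ᵇ ℝ) where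
  carrier := {x | ∃ L : ℝ, Filter.Tendsto (fun n => x n) Filter.atTop (nhds L)}
  add_mem' := by
    rintro x y ⟨L, hL⟩ ⟨L', hL'⟩
    exact ⟨L + L', hL.add hL'⟩
  zero_mem' := ⟨0, tendsto_const_nhds⟩
  smul_mem' := by
    rintro a x ⟨L, hL⟩
    exact ⟨a * L, hL.const_mul a⟩

/-- `Y` is almost isometric to a subspace of `Z`: for every `ε > 0` there is a bounded linear
operator `J : Y → Z` with `(1 - ε) ‖f‖ ≤ ‖J f‖ ≤ ‖f‖` for all `f ∈ Y`. -/
def AlmostIsometricToSubspace (Y Z : Type*) [NormedAddCommGroup Y] [NormedSpace ℝ Y]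
    [NormedAddCommGroup Z] [NormedSpace ℝ Z] : Prop :=
  ∀ ε : ℝ, 0 < ε → ∃ J : Y →L[ℝ] Z, ∀ f : Y, (1 - ε) * ‖f‖ ≤ ‖J f‖ ∧ ‖J f‖ ≤ ‖f‖

end Muntz

/-!
The unit ball of a Müntz space is equicontinuous at every point of `[0, 1)`. Granting this,
evaluation at a sequence `s n → 1` which is a sufficiently fine net in every compact part of
`[0, 1)` maps the whole space into the convergent sequences, does not increase norms, and loses at
most `ε ‖f‖`. So one may take `X = 0` and let `Y` be the whole space: as equicontinuity at `t = 0`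
holds for every `l 1 > 0`, no finite-dimensional part has to be split off.

For the equicontinuity, put `t = exp (-x)`. For `f` in the span, `h x = f (exp (-x)) - f 0` is a sum
`∑ a i exp (-ν i x)` with exponents `ν i = l (i + 1) > 0`, and `|h| ≤ 2 ‖f‖` on `(0, ∞)`. On
`(δ, ∞)` it has to be controlled independently of the number of terms.

* The Laplace transform of `h` continues to `F (-w) = ∑ a i / (ν i - w)`. With the weight
  `exp (-x)`, which shifts the exponents to `μ i = ν i + 1` and the variable to `w + 1`, the
  function lies in `L²(0, ∞)`. Removing the exponents one at a time by Blaschke factors bounds the transform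
  by the `L²` norm times the reciprocals of these factors (`norm_sq_sum_div_sub_le`). This step is
  finite algebra with the matrix `1 / (μ i + μ j)`.
* Because `∑ 1 / ν i` is finite, the product of the reciprocals is `O(exp (η r))` for every `η > 0`
  on the ray `w = r (1 + i)` (`exists_prod_le_mul_exp`).
* `h x` is a constant times the imaginary part of the integral of `exp (-x w) F (-w)` along this
  ray. It suffices to see this for one exponential, where it follows from a differential equation
  and a positivity argument (`exists_ne_zero_rayIntegral_im_eq`). As `|exp (-x w)| = exp (-r x)`,
  the growth of `F` is harmless for `x > η`, which gives equicontinuity on `(η, ∞)` and uniform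
  decay at infinity (`exists_abs_sum_exp_le`), that is equicontinuity of `f` on `(0, 1)` and at `0`
  (`eventually_abs_sub_le`).
-/

namespace Muntz

open MeasureTheory Set Filter Topology

/-! ### The Gram form of exponentials and Laplace transforms -/

/-- The Gram form `∑ a i a j / (μ i + μ j)` of the functions `x ↦ exp (-μ i x)` in `L²(0, ∞)`,
that is the square of the `L²` norm of `∑ a i exp (-μ i x)`; see `integral_sq_sum_exp`. -/
noncomputable def gramForm {ι : Type*} (s : Finset ι) (μ a : ι → ℝ) : ℝ :=
  ∑ i ∈ s, ∑ j ∈ s, a i * a j / (μ i + μ j)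

/-- The operator with symbol the Blaschke factor of `p`, acting on coefficients by
`a i ↦ a i (μ i - p) / (μ i + p)`, lowers the Gram form by exactly one squared functional. -/
lemma gramForm_reflect {ι : Type*} (s : Finset ι) (μ a : ι → ℝ) (hμ : ∀ i, 0 < μ i) (p : ℝ)
    (hp : 0 < p) :
    gramForm s μ (fun i => a i * ((μ i - p) / (μ i + p))) =
      gramForm s μ a - 2 * p * (∑ i ∈ s, a i / (μ i + p)) ^ 2 := by
  have h : ∀ i j, a i * ((μ i - p) / (μ i + p)) * (a j * ((μ j - p) / (μ j + p))) / (μ i + μ j)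
      = a i * a j / (μ i + μ j) - 2 * p * (a i / (μ i + p) * (a j / (μ j + p))) := by
    intro i j
    have h1 := hμ i
    have h2 := hμ j
    have : μ i + p ≠ 0 := by positivity
    have : μ j + p ≠ 0 := by positivity
    have : μ i + μ j ≠ 0 := by positivity
    field_simp
    ring
  simp only [gramForm, h, Finset.sum_sub_distrib, sq, Finset.sum_mul_sum]
  simp only [Finset.mul_sum]

lemma gramForm_insert_of_eq_zero {ι : Type*} [DecidableEq ι] {s : Finset ι} {j : ι} (hj : j ∉ s)
    (μ b : ι → ℝ) (hb : b j = 0) : gramForm (insert j s) μ b = gramForm s μ b := by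
  simp [gramForm, Finset.sum_insert hj, hb]

lemma gramForm_nonneg {ι : Type*} (s : Finset ι) (μ a : ι → ℝ) (hμ : ∀ i, 0 < μ i) :
    0 ≤ gramForm s μ a := by
  classical
  induction s using Finset.induction_on generalizing a with
  | empty => simp [gramForm]
  | insert j s hj ih =>
    have h := gramForm_reflect (insert j s) μ a hμ (μ j) (hμ j)
    rw [gramForm_insert_of_eq_zero hj μ _ (by simp)] at h
    have h1 := ih fun i => a i * ((μ i - μ j) / (μ i + μ j))
    have h2 := hμ j
    have : 0 ≤ 2 * μ j * (∑ i ∈ insert j s, a i / (μ i + μ j)) ^ 2 := by positivity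
    linarith

lemma add_sq_le_mul_of_sq_le {A B R T q e : ℝ} (hR : 0 ≤ R) (hT : 0 ≤ T)
    (hq : 0 ≤ q) (he : 0 ≤ e) (h1 : A ^ 2 ≤ R * T) (h2 : B ^ 2 ≤ q * e) :
    (A + B) ^ 2 ≤ (R + q) * (T + e) := by
  have h3 : (2 * (A * B)) ^ 2 ≤ (R * e + q * T) ^ 2 := by
    have := mul_le_mul h1 h2 (sq_nonneg B) (by positivity)
    nlinarith [sq_nonneg (R * e - q * T)]
  have h4 := abs_le_of_sq_le_sq' h3 (by positivity)
  nlinarith [h4.2]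

/-- A bound for the Laplace transform of `∑ a i exp (-μ i x)`, continued analytically to the point
`-w`, by the `L²` norm of the function. Removing one exponent at a time with `gramForm_reflect`
expands the transform in the Takenaka-Malmquist system; the Cauchy-Schwarz inequality at each
removal gives the sum, and the reciprocals of the Blaschke factors give the product. -/
lemma norm_sq_sum_div_sub_le {ι : Type*} (μ : ι → ℝ) (hμ : ∀ i, 0 < μ i) (w : ℂ)
    (hw : ∀ i, (μ i : ℂ) - w ≠ 0) (s : Finset ι) (a : ι → ℝ) :
    ‖∑ i ∈ s, (a i : ℂ) / (μ i - w)‖ ^ 2 ≤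
      gramForm s μ a * (∑ k ∈ s, 2 * μ k / ‖(μ k : ℂ) - w‖ ^ 2) *
        (∏ k ∈ s, (1 + 2 * ‖w‖ / ‖(μ k : ℂ) - w‖)) ^ 2 := by
  classical
  induction s using Finset.induction_on generalizing a with
  | empty => simp [gramForm]
  | insert j s hj ih =>
    have hp := hμ j
    set p := μ j with hpdef
    set b : ι → ℝ := fun i => a i * ((μ i - p) / (μ i + p)) with hb
    set V : ℝ := ∑ i ∈ insert j s, a i / (μ i + p) with hV
    have hbj : b j = 0 := by simp [hb, hpdef]
    have hQ : gramForm s μ b = gramForm (insert j s) μ a - 2 * p * V ^ 2 := by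
      rw [← gramForm_insert_of_eq_zero hj μ b hbj, hb, gramForm_reflect _ _ _ hμ p hp]
    have hpw : (p : ℂ) - w ≠ 0 := hw j
    -- Partial fractions: the transform of `a` in terms of that of the reflected coefficients `b`.
    have hF : ∑ i ∈ insert j s, (a i : ℂ) / (μ i - w) =
        -((p + w) / (p - w)) * ∑ i ∈ s, (b i : ℂ) / (μ i - w) + 2 * p * V / (p - w) := by
      have e1 : ∑ i ∈ s, (b i : ℂ) / (μ i - w) = ∑ i ∈ insert j s, (b i : ℂ) / (μ i - w) := by
        rw [Finset.sum_insert hj, hbj]; simp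
      rw [e1, hV, Complex.ofReal_sum, Finset.mul_sum, Finset.mul_sum, Finset.sum_div,
        ← Finset.sum_add_distrib]
      refine Finset.sum_congr rfl fun i _ => ?_
      have h1 : (μ i : ℂ) + p ≠ 0 := by
        have := hμ i
        exact_mod_cast (by positivity : μ i + p ≠ 0)
      have h2 := hw i
      simp only [hb]
      push_cast
      field_simp
      ring
    have hd : 0 < ‖(p : ℂ) - w‖ := norm_pos_iff.2 hpw
    set d := ‖(p : ℂ) - w‖ with hddef
    set β : ℝ := 1 + 2 * ‖w‖ / d with hβ
    have hβ1 : 1 ≤ β := by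
      have : 0 ≤ 2 * ‖w‖ / d := by positivity
      linarith
    have hβ' : ‖((p : ℂ) + w) / (p - w)‖ ≤ β := by
      rw [norm_div, ← hddef, div_le_iff₀ hd, hβ, add_mul, div_mul_cancel₀ _ hd.ne', one_mul]
      calc ‖(p : ℂ) + w‖ = ‖((p : ℂ) - w) + 2 * w‖ := by ring_nf
        _ ≤ d + ‖2 * w‖ := norm_add_le _ _
        _ = _ := by simp
    rw [Finset.sum_insert (f := fun k => 2 * μ k / ‖(μ k : ℂ) - w‖ ^ 2) hj, Finset.prod_insert hj]
    set S := ∑ k ∈ s, 2 * μ k / ‖(μ k : ℂ) - w‖ ^ 2 with hS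
    set P := ∏ k ∈ s, (1 + 2 * ‖w‖ / ‖(μ k : ℂ) - w‖) with hP
    have hS0 : 0 ≤ S := Finset.sum_nonneg fun k _ => by have := hμ k; positivity
    have hP1 : 1 ≤ P := by
      refine Finset.one_le_prod fun k _ => ?_
      have : 0 ≤ 2 * ‖w‖ / ‖(μ k : ℂ) - w‖ := by positivity
      linarith
    have ih' := ih b
    set N := ‖∑ i ∈ s, (b i : ℂ) / (μ i - w)‖ with hN
    rw [hQ] at ih'
    set Q := gramForm (insert j s) μ a with hQdef
    have hN0 : 0 ≤ N := norm_nonneg _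
    have hle : ‖∑ i ∈ insert j s, (a i : ℂ) / (μ i - w)‖ ≤ β * N + 2 * p * |V| / d := by
      rw [hF]
      refine (norm_add_le _ _).trans (add_le_add ?_ ?_)
      · rw [norm_mul, norm_neg]
        exact mul_le_mul_of_nonneg_right hβ' hN0
      · rw [norm_div, ← hddef]
        simp [abs_of_pos hp]
    have hβP : 1 ≤ (β * P) ^ 2 := one_le_pow₀ (one_le_mul_of_one_le_of_one_le hβ1 hP1)
    have key := add_sq_le_mul_of_sq_le (A := β * N) (B := 2 * p * |V| / d)
      (R := Q - 2 * p * V ^ 2) (T := S * (β * P) ^ 2) (q := 2 * p * V ^ 2)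
      (e := 2 * p / d ^ 2 * (β * P) ^ 2)
      (hQ ▸ gramForm_nonneg s μ b hμ) (by positivity) (by positivity) (by positivity)
      (by
        calc (β * N) ^ 2 = β ^ 2 * N ^ 2 := by ring
          _ ≤ β ^ 2 * ((Q - 2 * p * V ^ 2) * S * P ^ 2) := by gcongr
          _ = _ := by ring)
      (by
        calc (2 * p * |V| / d) ^ 2 = 2 * p * V ^ 2 * (2 * p / d ^ 2) * 1 := by
              rw [div_pow, mul_pow, sq_abs]; ring
          _ ≤ 2 * p * V ^ 2 * (2 * p / d ^ 2) * (β * P) ^ 2 := by gcongr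
          _ = _ := by ring)
    calc _ ≤ (β * N + 2 * p * |V| / d) ^ 2 := by gcongr
      _ ≤ _ := key
      _ = _ := by ring

/-! ### Recovery of an exponential from its transform on a ray -/

/-- The direction `1 + i` of the ray along which Laplace transforms are integrated. -/
noncomputable def ray : ℂ := 1 + Complex.I

lemma norm_ray_le : ‖ray‖ ≤ 2 := by
  refine (norm_add_le _ _).trans ?_
  simp; norm_num

lemma sq_norm_sub_mul_ray (ν r : ℝ) : ‖(ν : ℂ) - r * ray‖ ^ 2 = (ν - r) ^ 2 + r ^ 2 := by
  rw [Complex.sq_norm, Complex.normSq_apply]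
  simp [ray]
  ring

lemma le_norm_sub_mul_ray (ν r : ℝ) : r ≤ ‖(ν : ℂ) - r * ray‖ := by
  refine (abs_le_of_sq_le_sq' ?_ (norm_nonneg _)).2
  rw [sq_norm_sub_mul_ray]
  nlinarith [sq_nonneg (ν - r)]

lemma half_le_norm_sub_mul_ray (ν r : ℝ) : ν / 2 ≤ ‖(ν : ℂ) - r * ray‖ := by
  refine (abs_le_of_sq_le_sq' ?_ (norm_nonneg _)).2
  rw [sq_norm_sub_mul_ray]
  nlinarith [sq_nonneg (ν - 2 * r), sq_nonneg ν]

lemma sub_mul_ray_ne_zero {ν : ℝ} (hν : 0 < ν) (r : ℝ) : (ν : ℂ) - r * ray ≠ 0 := by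
  rw [← norm_pos_iff]
  linarith [half_le_norm_sub_mul_ray ν r]

lemma norm_exp_neg_mul_ray (r x : ℝ) : ‖Complex.exp (-(r * x * ray))‖ = Real.exp (-(r * x)) := by
  simp [Complex.norm_exp, ray]

/-- The integral of `exp (-x w) / (ν - w)` along the ray `w = r (1 + i)`, `r > 0`. Twice its
imaginary part is, up to the factor `i`, the integral over a contour around the pole `w = ν`. -/
noncomputable def rayIntegral (ν x : ℝ) : ℂ :=
  ∫ r in Ioi (0 : ℝ), Complex.exp (-(r * x * ray)) * (ray / (ν - r * ray))

lemma continuous_rayIntegrand {ν : ℝ} (hν : 0 < ν) (x : ℝ) :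
    Continuous fun r : ℝ => Complex.exp (-(r * x * ray)) * (ray / ((ν : ℂ) - r * ray)) := by
  have h : Continuous fun r : ℝ => ray / ((ν : ℂ) - r * ray) :=
    continuous_const.div (by fun_prop) fun r => sub_mul_ray_ne_zero hν r
  exact Continuous.mul (by fun_prop) h

lemma norm_ray_div_le {ν : ℝ} (hν : 0 < ν) (r : ℝ) : ‖ray / ((ν : ℂ) - r * ray)‖ ≤ 4 / ν := by
  rw [norm_div]
  calc _ ≤ 2 / (ν / 2) := by
        gcongr
        · exact norm_ray_le
        · exact half_le_norm_sub_mul_ray ν r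
    _ = 4 / ν := by field_simp; norm_num

lemma integrableOn_exp_neg_mul {x : ℝ} (hx : 0 < x) :
    IntegrableOn (fun r : ℝ => Real.exp (-(r * x))) (Ioi 0) := by
  simpa [mul_comm] using exp_neg_integrableOn_Ioi 0 hx

lemma integrableOn_rayIntegrand {ν x : ℝ} (hν : 0 < ν) (hx : 0 < x) :
    IntegrableOn (fun r : ℝ => Complex.exp (-(r * x * ray)) * (ray / ((ν : ℂ) - r * ray)))
      (Ioi 0) := by
  refine ((integrableOn_exp_neg_mul hx).mul_const (4 / ν)).mono'
    (continuous_rayIntegrand hν x).aestronglyMeasurable (ae_of_all _ fun r => ?_)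
  rw [norm_mul, norm_exp_neg_mul_ray]
  exact mul_le_mul_of_nonneg_left (norm_ray_div_le hν r) (Real.exp_pos _).le

lemma integral_exp_neg_mul_ray {x : ℝ} (hx : 0 < x) :
    ∫ r in Ioi (0 : ℝ), Complex.exp (-(r * x * ray)) * ray = 1 / x := by
  rw [integral_mul_const]
  have h := integral_exp_mul_complex_Ioi (a := -(x * ray)) (by simp [ray, hx]) 0
  have hr : ray ≠ 0 := fun h => by simpa [ray] using congrArg Complex.re h
  have hx' : (x : ℂ) ≠ 0 := by exact_mod_cast hx.ne'
  have e : ∀ r : ℝ, Complex.exp (-(r * x * ray)) = Complex.exp (-(x * ray) * r) := fun r => by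
    congr 1; ring
  simp_rw [e, h]
  simp
  field_simp

/-- The imaginary part of this differential equation is homogeneous, because `1 / x` is real. -/
lemma hasDerivAt_rayIntegral {ν x : ℝ} (hν : 0 < ν) (hx : 0 < x) :
    HasDerivAt (rayIntegral ν) (1 / x - ν * rayIntegral ν x) x := by
  have hF' : ∀ (y r : ℝ), HasDerivAt
      (fun y : ℝ => Complex.exp (-(r * y * ray)) * (ray / ((ν : ℂ) - r * ray)))
      (Complex.exp (-(r * y * ray)) * ray - ν * (Complex.exp (-(r * y * ray)) *
        (ray / ((ν : ℂ) - r * ray)))) y := by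
    intro y r
    have h1 : HasDerivAt (fun y : ℝ => -((r : ℂ) * y * ray)) (-(r * ray)) y := by
      simpa using! (((hasDerivAt_id y).ofReal_comp.const_mul (r : ℂ)).mul_const ray).neg
    convert! h1.cexp.mul_const (ray / ((ν : ℂ) - r * ray)) using 1
    have := sub_mul_ray_ne_zero hν r
    field_simp
    ring
  have hb : ∀ (y r : ℝ), 0 < r → ‖Complex.exp (-(r * y * ray)) * ray -
      ν * (Complex.exp (-(r * y * ray)) * (ray / ((ν : ℂ) - r * ray)))‖ ≤
        Real.exp (-(r * y)) * 6 := by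
    intro y r hr
    have e : Complex.exp (-(r * y * ray)) * ray - ν * (Complex.exp (-(r * y * ray)) *
        (ray / ((ν : ℂ) - r * ray))) = Complex.exp (-(r * y * ray)) *
          (ray - ν * (ray / ((ν : ℂ) - r * ray))) := by ring
    rw [e, norm_mul, norm_exp_neg_mul_ray]
    refine mul_le_mul_of_nonneg_left ?_ (Real.exp_pos _).le
    calc _ ≤ ‖ray‖ + ‖(ν : ℂ) * (ray / ((ν : ℂ) - r * ray))‖ := norm_sub_le _ _
      _ ≤ 2 + ν * (4 / ν) := by
        gcongr
        · exact norm_ray_le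
        · rw [norm_mul, Complex.norm_real, Real.norm_of_nonneg hν.le]
          gcongr
          exact norm_ray_div_le hν r
      _ = 6 := by field_simp; norm_num
  have key := hasDerivAt_integral_of_dominated_loc_of_deriv_le (μ := volume.restrict (Ioi (0 : ℝ)))
    (F := fun (y : ℝ) (r : ℝ) => Complex.exp (-(r * y * ray)) * (ray / ((ν : ℂ) - r * ray)))
    (F' := fun (y : ℝ) (r : ℝ) => Complex.exp (-(r * y * ray)) * ray -
      ν * (Complex.exp (-(r * y * ray)) * (ray / ((ν : ℂ) - r * ray))))
    (bound := fun r => Real.exp (-(r * (x / 2))) * 6) (x₀ := x) (s := Ioi (x / 2))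
    (Ioi_mem_nhds (by linarith))
    (Eventually.of_forall fun y => (continuous_rayIntegrand hν y).aestronglyMeasurable)
    (integrableOn_rayIntegrand hν hx)
    (Continuous.aestronglyMeasurable (by
      have := continuous_rayIntegrand hν x
      fun_prop))
    (by
      filter_upwards [ae_restrict_mem measurableSet_Ioi] with r hr y hy
      refine (hb y r hr).trans ?_
      have : r * (x / 2) ≤ r * y := mul_le_mul_of_nonneg_left (le_of_lt hy) (le_of_lt hr)
      gcongr)
    ((integrableOn_exp_neg_mul (half_pos hx)).mul_const 6)
    (ae_of_all _ fun r y _ => hF' y r)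
  have h2 := key.2
  rw [integral_sub, integral_exp_neg_mul_ray hx, integral_const_mul] at h2
  · exact h2
  · refine ((integrableOn_exp_neg_mul hx).mul_const 2).mono'
      (Continuous.aestronglyMeasurable (by fun_prop)) (ae_of_all _ fun r => ?_)
    rw [norm_mul, norm_exp_neg_mul_ray]
    exact mul_le_mul_of_nonneg_left norm_ray_le (Real.exp_pos _).le
  · exact (integrableOn_rayIntegrand hν hx).const_mul _

lemma rayIntegral_eq_one_mul {ν : ℝ} (hν : 0 < ν) (x : ℝ) :
    rayIntegral ν x = rayIntegral 1 (ν * x) := by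
  have h := integral_comp_mul_left_Ioi
    (fun r : ℝ => Complex.exp (-(r * x * ray)) * (ν * ray / ((ν : ℂ) - r * ray))) 0 hν
  have hν' : (ν : ℂ) ≠ 0 := by exact_mod_cast hν.ne'
  rw [mul_zero] at h
  have e1 : rayIntegral 1 (ν * x) = ∫ r in Ioi (0 : ℝ),
      Complex.exp (-(((ν * r : ℝ) : ℂ) * x * ray)) *
      (ν * ray / ((ν : ℂ) - ((ν * r : ℝ) : ℂ) * ray)) := by
    refine integral_congr_ae (ae_of_all _ fun r => ?_)
    have h1 := sub_mul_ray_ne_zero one_pos r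
    have h2 : (ν : ℂ) - ((ν * r : ℝ) : ℂ) * ray = ν * (((1 : ℝ) : ℂ) - r * ray) := by
      push_cast; ring
    simp only [h2]
    rw [mul_div_mul_left _ _ hν']
    congr 2
    push_cast; ring
  rw [e1, h, rayIntegral, ← integral_smul]
  refine integral_congr_ae (ae_of_all _ fun r => ?_)
  simp only [Complex.real_smul, Complex.ofReal_inv]
  field_simp

/-- The imaginary part of `rayIntegral ν` is a multiple of `exp (-ν x)`, with a factor that does
not depend on `ν`, by scaling. -/
lemma exists_rayIntegral_im_eq :
    ∃ c : ℝ, ∀ ν > 0, ∀ x > 0, (rayIntegral ν x).im = c * Real.exp (-(ν * x)) := by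
  have hd : ∀ x : ℝ, 0 < x → HasDerivAt (fun y => (rayIntegral 1 y).im * Real.exp y) 0 x := by
    intro x hx
    have h1 := (hasDerivAt_rayIntegral one_pos hx)
    have h2 : HasDerivAt (fun y => (rayIntegral 1 y).im)
        (1 / (x : ℂ) - (1 : ℝ) * rayIntegral 1 x).im x :=
      (Complex.imCLM.hasFDerivAt.comp_hasDerivAt x h1)
    have h3 := h2.mul (Real.hasDerivAt_exp x)
    convert! h3 using 1
    have : (1 / (x : ℂ)).im = 0 := by rw [← Complex.ofReal_one, ← Complex.ofReal_div]; rfl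
    rw [Complex.sub_im, this]
    simp
  obtain ⟨c, hc⟩ := isOpen_Ioi.exists_is_const_of_deriv_eq_zero (isPreconnected_Ioi (a := (0 : ℝ)))
    (fun x hx => (hd x hx).differentiableAt.differentiableWithinAt) (fun x hx => (hd x hx).deriv)
  refine ⟨c, fun ν hν x hx => ?_⟩
  rw [rayIntegral_eq_one_mul hν, ← hc (ν * x) (mul_pos hν hx), mul_assoc, ← Real.exp_add]
  simp

/-! ### The recovery constant does not vanish -/

lemma integral_exp_neg_mul_one_add_ray {r : ℝ} (hr : 0 < r) :
    ∫ x in Ioi (0 : ℝ), Complex.exp (-(x * (1 + r * ray))) = 1 / (1 + r * ray) := by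
  have h := integral_exp_mul_complex_Ioi (a := -(1 + r * ray)) (by simp [ray]; linarith) 0
  have e : ∀ x : ℝ, Complex.exp (-(x * (1 + r * ray))) = Complex.exp (-(1 + r * ray) * x) :=
    fun x => by congr 1; ring
  simp_rw [e, h]
  simp [-neg_add_rev, neg_div_neg_eq]

lemma one_add_sq_le_mul_norm (r : ℝ) (hr : 0 < r) :
    1 + r ^ 2 ≤ 2 * ((1 + r) * ‖((1 : ℝ) : ℂ) - r * ray‖) := by
  refine (abs_le_of_sq_le_sq' ?_ (by positivity)).2
  rw [mul_pow, mul_pow, sq_norm_sub_mul_ray]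
  nlinarith [sq_nonneg (r * (r - 1)), sq_nonneg (r - 1), mul_pos hr hr,
    mul_pos (mul_pos hr hr) hr, sq_nonneg (r ^ 2 - 1), sq_nonneg (r ^ 2 - r / 2),
    sq_nonneg (r - 1 / 2)]

lemma integrable_rayIntegrand_prod : Integrable (Function.uncurry fun x r : ℝ =>
      Complex.exp (-(x * (1 + r * ray))) * (ray / (((1 : ℝ) : ℂ) - r * ray)))
    ((volume.restrict (Ioi 0)).prod (volume.restrict (Ioi 0))) := by
  have hc : Continuous fun r : ℝ => ray / (((1 : ℝ) : ℂ) - r * ray) :=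
    continuous_const.div (by fun_prop) fun r => sub_mul_ray_ne_zero one_pos r
  have hcont : Continuous (Function.uncurry fun x r : ℝ =>
      Complex.exp (-(x * (1 + r * ray))) * (ray / (((1 : ℝ) : ℂ) - r * ray))) := by
    refine Continuous.mul ?_ (hc.comp continuous_snd)
    fun_prop
  have hn : ∀ x r : ℝ, ‖Complex.exp (-(x * (1 + r * ray))) * (ray / (((1 : ℝ) : ℂ) - r * ray))‖
      = Real.exp (-(x * (1 + r))) * ‖ray / (((1 : ℝ) : ℂ) - r * ray)‖ := by
    intro x r
    rw [norm_mul, Complex.norm_exp]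
    simp [ray]
  rw [integrable_prod_iff' hcont.aestronglyMeasurable]
  constructor
  · filter_upwards [ae_restrict_mem measurableSet_Ioi] with r hr
    have hr : 0 < r := hr
    refine (((integrableOn_exp_neg_mul (x := 1 + r) (by linarith)).mul_const
      ‖ray / (((1 : ℝ) : ℂ) - r * ray)‖)).mono'
      (hcont.comp (by fun_prop : Continuous fun x : ℝ => (x, r))).aestronglyMeasurable
      (ae_of_all _ fun x => ?_)
    exact (hn x r).le
  · refine (integrable_inv_one_add_sq.const_mul 4).integrableOn.mono' ?_ ?_
    · exact (hcont.norm.aestronglyMeasurable (μ := (volume.restrict (Ioi 0)).prod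
        (volume.restrict (Ioi 0)))).prod_swap.integral_prod_right'
    · filter_upwards [ae_restrict_mem measurableSet_Ioi] with r hr
      have hr : 0 < r := hr
      simp only [Function.uncurry, hn]
      rw [integral_mul_const]
      have h1 : ∫ x in Ioi (0 : ℝ), Real.exp (-(x * (1 + r))) = 1 / (1 + r) := by
        have := integral_exp_mul_Ioi (a := -(1 + r)) (by linarith) 0
        have e : ∀ x : ℝ, Real.exp (-(x * (1 + r))) = Real.exp (-(1 + r) * x) :=
          fun x => by congr 1; ring
        simp_rw [e, this]
        simp [-neg_add_rev, neg_div_neg_eq]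
      rw [h1, Real.norm_of_nonneg (by positivity), norm_div]
      have h2 := one_add_sq_le_mul_norm r hr
      have h3 : 0 < ‖((1 : ℝ) : ℂ) - r * ray‖ := norm_pos_iff.2 (sub_mul_ray_ne_zero one_pos r)
      rw [div_mul_div_comm, one_mul, ← div_eq_mul_inv,
        div_le_div_iff₀ (by positivity) (by positivity)]
      calc ‖ray‖ * (1 + r ^ 2) ≤ 2 * (2 * ((1 + r) * ‖((1 : ℝ) : ℂ) - r * ray‖)) := by
            gcongr
            exact norm_ray_le
        _ = _ := by ring

/-- By Fubini, the Laplace transform of `(rayIntegral 1 ·).im` at `1` is the integral over `r > 0`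
of the imaginary part of `ray / ((1 + r * ray) * (1 - r * ray))`, which is positive. -/
lemma exists_pos_rayIntegral_im_ne_zero : ∃ x > 0, (rayIntegral 1 x).im ≠ 0 := by
  by_contra! hz
  have hint := integrable_rayIntegrand_prod
  have hswap := integral_integral_swap hint
  have hl : ∀ x : ℝ, ∫ r in Ioi (0 : ℝ),
      Complex.exp (-(x * (1 + r * ray))) * (ray / (((1 : ℝ) : ℂ) - r * ray)) =
        (Real.exp (-x) : ℂ) * rayIntegral 1 x := by
    intro x
    rw [rayIntegral, ← integral_const_mul]
    refine integral_congr_ae (ae_of_all _ fun r => ?_)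
    simp only
    rw [← mul_assoc, Complex.ofReal_exp, ← Complex.exp_add]
    congr 2
    push_cast; ring
  have hr : ∀ r : ℝ, 0 < r → ∫ x in Ioi (0 : ℝ),
      Complex.exp (-(x * (1 + r * ray))) * (ray / (((1 : ℝ) : ℂ) - r * ray)) =
        1 / (1 + r * ray) * (ray / (((1 : ℝ) : ℂ) - r * ray)) := by
    intro r hr
    rw [integral_mul_const, integral_exp_neg_mul_one_add_ray hr]
  have him : ∀ r : ℝ, 0 < r → 0 < (1 / (1 + r * ray) * (ray / (((1 : ℝ) : ℂ) - r * ray))).im := by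
    intro r hr
    have h1 : (1 / (1 + r * ray) * (ray / (((1 : ℝ) : ℂ) - r * ray))) =
        ((1 / (1 + 4 * r ^ 4) : ℝ) : ℂ) *
          ((1 - 2 * r ^ 2 : ℝ) + (1 + 2 * r ^ 2 : ℝ) * Complex.I) := by
      have h2 := sub_mul_ray_ne_zero one_pos r
      have h3 : (1 : ℂ) + r * ray ≠ 0 := fun h => by
        have := congrArg Complex.re h
        simp [ray] at this
        linarith
      have h4 : ((1 + 4 * r ^ 4 : ℝ) : ℂ) ≠ 0 := by
        exact_mod_cast (by positivity : (1 + 4 * r ^ 4 : ℝ) ≠ 0)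
      rw [div_mul_div_comm, one_mul, div_eq_iff (mul_ne_zero h3 h2), Complex.ofReal_div,
        div_mul_eq_mul_div, div_mul_eq_mul_div, eq_div_iff h4]
      apply Complex.ext
      · simp [ray, pow_succ]; ring
      · simp [ray, pow_succ]; ring
    rw [h1, Complex.im_ofReal_mul]
    simp only [Complex.add_im, Complex.ofReal_im, Complex.im_ofReal_mul, Complex.I_im]
    positivity
  simp_rw [hl] at hswap
  have hint2 := hint.integral_prod_right
  have hint1 := hint.integral_prod_left
  simp only [Function.uncurry, hl] at hint1 hint2
  have h0 : (∫ x in Ioi (0 : ℝ), (Real.exp (-x) : ℂ) * rayIntegral 1 x).im = 0 := by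
    rw [← Complex.imCLM_apply, ← Complex.imCLM.integral_comp_comm hint1]
    refine setIntegral_eq_zero_of_forall_eq_zero fun x hx => ?_
    rw [Complex.imCLM_apply, Complex.im_ofReal_mul, hz x hx, mul_zero]
  rw [hswap, ← Complex.imCLM_apply, ← Complex.imCLM.integral_comp_comm hint2] at h0
  have hpos : 0 < ∫ r in Ioi (0 : ℝ), Complex.imCLM (∫ x in Ioi (0 : ℝ),
      Complex.exp (-(x * (1 + r * ray))) * (ray / (((1 : ℝ) : ℂ) - r * ray))) := by
    rw [setIntegral_pos_iff_support_of_nonneg_ae]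
    · have : Ioi (0 : ℝ) ⊆ (Function.support fun r : ℝ => Complex.imCLM (∫ x in Ioi (0 : ℝ),
          Complex.exp (-(x * (1 + r * ray))) * (ray / (((1 : ℝ) : ℂ) - r * ray)))) ∩ Ioi 0 := by
        intro r hr0
        refine ⟨?_, hr0⟩
        rw [Function.mem_support, hr r hr0, Complex.imCLM_apply]
        exact (him r hr0).ne'
      exact lt_of_lt_of_le (by simp) (measure_mono this)
    · filter_upwards [ae_restrict_mem measurableSet_Ioi] with r hr0
      rw [hr r hr0, Complex.imCLM_apply]
      exact (him r hr0).le
    · exact Complex.imCLM.integrable_comp hint2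
  exact hpos.ne' h0

/-- Recovery of `exp (-ν x)` from its Laplace transform on the ray, with a constant common to all
`ν`. -/
lemma exists_ne_zero_rayIntegral_im_eq :
    ∃ c : ℝ, c ≠ 0 ∧ ∀ ν > 0, ∀ x > 0, (rayIntegral ν x).im = c * Real.exp (-(ν * x)) := by
  obtain ⟨c, hc⟩ := exists_rayIntegral_im_eq
  obtain ⟨x, hx, h⟩ := exists_pos_rayIntegral_im_ne_zero
  refine ⟨c, fun h0 => h ?_, hc⟩
  rw [hc 1 one_pos x hx, h0, zero_mul]

/-! ### Equicontinuity of bounded exponential sums -/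

lemma integral_sq_sum_exp {ι : Type*} (s : Finset ι) (μ a : ι → ℝ) (hμ : ∀ i, 0 < μ i) :
    IntegrableOn (fun x : ℝ => (∑ i ∈ s, a i * Real.exp (-(μ i * x))) ^ 2) (Ioi 0) ∧
    ∫ x in Ioi (0 : ℝ), (∑ i ∈ s, a i * Real.exp (-(μ i * x))) ^ 2 = gramForm s μ a := by
  have e : ∀ x : ℝ, (∑ i ∈ s, a i * Real.exp (-(μ i * x))) ^ 2 =
      ∑ i ∈ s, ∑ j ∈ s, a i * a j * Real.exp (-(x * (μ i + μ j))) := by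
    intro x
    rw [sq, Finset.sum_mul_sum]
    refine Finset.sum_congr rfl fun i _ => Finset.sum_congr rfl fun j _ => ?_
    rw [mul_mul_mul_comm, ← Real.exp_add]
    congr 2
    ring
  have hi : ∀ i j, IntegrableOn (fun x : ℝ => a i * a j * Real.exp (-(x * (μ i + μ j)))) (Ioi 0) :=
    fun i j => (integrableOn_exp_neg_mul (add_pos (hμ i) (hμ j))).const_mul _
  simp_rw [e]
  refine ⟨integrable_finsetSum _ fun i _ => integrable_finsetSum _ fun j _ => hi i j, ?_⟩
  rw [integral_finsetSum _ fun i _ => integrable_finsetSum _ fun j _ => hi i j, gramForm]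
  refine Finset.sum_congr rfl fun i _ => ?_
  rw [integral_finsetSum _ fun j _ => hi i j]
  refine Finset.sum_congr rfl fun j _ => ?_
  have h := integral_exp_mul_Ioi (a := -(μ i + μ j)) (by linarith [hμ i, hμ j]) 0
  have e : ∀ x : ℝ, Real.exp (-(x * (μ i + μ j))) = Real.exp (-(μ i + μ j) * x) :=
    fun x => by congr 1; ring
  simp_rw [e, integral_const_mul, h]
  rw [mul_zero, Real.exp_zero, neg_div_neg_eq, mul_one_div]

/-- Raising all exponents by one multiplies the function by `exp (-x)`, so a bounded exponential
sum becomes square integrable. -/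
lemma gramForm_add_one_le {ι : Type*} (s : Finset ι) (ν a : ι → ℝ) (hν : ∀ i, 0 < ν i) {M : ℝ}
    (hM : ∀ x : ℝ, 0 < x → |∑ i ∈ s, a i * Real.exp (-(ν i * x))| ≤ M) :
    gramForm s (fun i => ν i + 1) a ≤ M ^ 2 := by
  have hμ : ∀ i, 0 < ν i + 1 := fun i => by linarith [hν i]
  obtain ⟨h1, h2⟩ := integral_sq_sum_exp s (fun i => ν i + 1) a hμ
  have h3 : ∫ x in Ioi (0 : ℝ), M ^ 2 * Real.exp (-x) = M ^ 2 := by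
    rw [integral_const_mul, integral_exp_neg_Ioi_zero, mul_one]
  rw [← h2, ← h3]
  have hi : IntegrableOn (fun x : ℝ => Real.exp (-x)) (Ioi 0) := by
    simpa using integrableOn_exp_neg_mul one_pos
  refine setIntegral_mono_on h1 (hi.const_mul _) measurableSet_Ioi fun x hx => ?_
  have hx : 0 < x := hx
  have e : ∑ i ∈ s, a i * Real.exp (-((ν i + 1) * x)) =
      (∑ i ∈ s, a i * Real.exp (-(ν i * x))) * Real.exp (-x) := by
    rw [Finset.sum_mul]
    refine Finset.sum_congr rfl fun i _ => ?_
    rw [mul_assoc, ← Real.exp_add]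
    congr 2
    ring
  simp only [e, mul_pow]
  have h4 : (∑ i ∈ s, a i * Real.exp (-(ν i * x))) ^ 2 ≤ M ^ 2 := by
    rw [← sq_abs]
    exact pow_le_pow_left₀ (abs_nonneg _) (hM x hx) 2
  have h5 : Real.exp (-x) ^ 2 ≤ Real.exp (-x) := by
    have : Real.exp (-x) ≤ 1 := Real.exp_le_one_iff.2 (by linarith)
    nlinarith [Real.exp_pos (-x)]
  exact mul_le_mul h4 h5 (by positivity) (by positivity)

lemma norm_one_add_mul_ray_le {r : ℝ} (hr : 0 < r) : ‖1 + r * ray‖ ≤ 1 + 2 * r := by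
  refine (norm_add_le _ _).trans ?_
  rw [norm_one, norm_mul, Complex.norm_real, Real.norm_of_nonneg hr.le]
  nlinarith [norm_ray_le]

lemma two_mul_norm_div_le_div {ν r : ℝ} (hν : 0 < ν) (hr : 0 < r) :
    2 * ‖1 + r * ray‖ / ‖(ν : ℂ) - r * ray‖ ≤ (4 + 8 * r) * (1 / ν) := by
  calc _ ≤ 2 * (1 + 2 * r) / (ν / 2) := by
        gcongr
        · exact norm_one_add_mul_ray_le hr
        · exact half_le_norm_sub_mul_ray ν r
    _ = _ := by field_simp; ring

lemma two_mul_norm_div_le_const {ν r : ℝ} (hν : 0 < ν) (hr : 0 < r) :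
    2 * ‖1 + r * ray‖ / ‖(ν : ℂ) - r * ray‖ ≤ 4 + 4 / ν := by
  have h1 := norm_one_add_mul_ray_le hr
  have h2 := half_le_norm_sub_mul_ray ν r
  have h3 := le_norm_sub_mul_ray ν r
  rw [div_le_iff₀ (by linarith)]
  have h4 : 4 / ν * (ν / 2) ≤ 4 / ν * ‖(ν : ℂ) - r * ray‖ := by gcongr
  have h5 : 4 / ν * (ν / 2) = 2 := by field_simp; norm_num
  linarith

/-- The reciprocals of the Blaschke factors grow on the ray like `exp (η r)` for arbitrarily small
`η`: finitely many factors are bounded, and the others are at most `exp ((4 + 8 r) / ν k)`, where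
the sum of their `1 / ν k` is small. -/
lemma exists_prod_le_mul_exp {ν : ℕ → ℝ} (hν : ∀ i, 0 < ν i) (hs : Summable fun i => 1 / ν i)
    {η : ℝ} (hη : 0 < η) :
    ∃ C > 0, ∀ (s : Finset ℕ), ∀ r : ℝ, 0 < r →
      ∏ k ∈ s, (1 + 2 * ‖1 + r * ray‖ / ‖(ν k : ℂ) - r * ray‖) ≤ C * Real.exp (η * r) := by
  obtain ⟨u, hu⟩ := summable_iff_vanishing_norm.1 hs (η / 8) (by positivity)
  refine ⟨(∏ k ∈ u, (5 + 4 / ν k)) * Real.exp (η / 2), ?_, fun s r hr => ?_⟩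
  · exact mul_pos (Finset.prod_pos fun k _ => by have := hν k; positivity) (Real.exp_pos _)
  have h1 : ∏ k ∈ s ∩ u, (1 + 2 * ‖1 + r * ray‖ / ‖(ν k : ℂ) - r * ray‖) ≤
      ∏ k ∈ u, (5 + 4 / ν k) := by
    calc _ ≤ ∏ k ∈ s ∩ u, (5 + 4 / ν k) := by
          refine Finset.prod_le_prod (fun k _ => by positivity) fun k _ => ?_
          linarith [two_mul_norm_div_le_const (hν k) hr]
      _ ≤ _ := by
          refine Finset.prod_le_prod_of_subset_of_one_le (Finset.inter_subset_right)
            (fun k _ => by have := hν k; positivity) fun k _ _ => ?_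
          have : 0 < 4 / ν k := div_pos four_pos (hν k)
          linarith
  have h2 : ∏ k ∈ s \ u, (1 + 2 * ‖1 + r * ray‖ / ‖(ν k : ℂ) - r * ray‖) ≤
      Real.exp (η / 2 + η * r) := by
    calc _ ≤ ∏ k ∈ s \ u, Real.exp ((4 + 8 * r) * (1 / ν k)) := by
          refine Finset.prod_le_prod (fun k _ => by positivity) fun k _ => ?_
          refine le_trans ?_ (Real.add_one_le_exp _)
          linarith [two_mul_norm_div_le_div (hν k) hr]
      _ = Real.exp ((4 + 8 * r) * ∑ k ∈ s \ u, 1 / ν k) := by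
          rw [← Real.exp_sum, Finset.mul_sum]
      _ ≤ _ := by
          have h3 := (le_abs_self _).trans (hu (s \ u) Finset.sdiff_disjoint).le
          refine Real.exp_le_exp.2 ((mul_le_mul_of_nonneg_left h3 (by positivity)).trans ?_)
          linarith
  rw [← Finset.prod_inter_mul_prod_sdiff s u, mul_assoc, ← Real.exp_add]
  refine mul_le_mul h1 h2 (Finset.prod_nonneg fun k _ => by positivity) ?_
  exact Finset.prod_nonneg fun k _ => by have := hν k; positivity

/-- The Laplace transform of a bounded exponential sum grows on the ray at most like `exp (η r)`,
with a constant that does not depend on the number of terms. -/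
lemma exists_norm_sum_div_sub_mul_ray_le {ν : ℕ → ℝ} (hν : ∀ i, 0 < ν i)
    (hs : Summable fun i => 1 / ν i) {η : ℝ} (hη : 0 < η) :
    ∃ C > 0, ∀ (s : Finset ℕ) (a : ℕ → ℝ) (M : ℝ),
      (∀ x : ℝ, 0 < x → |∑ i ∈ s, a i * Real.exp (-(ν i * x))| ≤ M) → ∀ r : ℝ, 0 < r →
        ‖∑ i ∈ s, (a i : ℂ) / (ν i - r * ray)‖ ≤ C * M * Real.exp (η * r) := by
  obtain ⟨C, hC, hprod⟩ := exists_prod_le_mul_exp hν hs hη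
  set T := ∑' i, 1 / ν i with hT
  have hT0 : 0 < T := hs.tsum_pos (fun i => (one_div_pos.2 (hν i)).le) 0 (one_div_pos.2 (hν 0))
  refine ⟨Real.sqrt (8 * (1 + T) * T) * C, by positivity, fun s a M hM r hr => ?_⟩
  have hM0 : 0 ≤ M := (abs_nonneg _).trans (hM 1 one_pos)
  have hμ : ∀ i, 0 < ν i + 1 := fun i => by linarith [hν i]
  -- Exponents and evaluation point are both shifted by one, which keeps their differences.
  have e : ∀ i, (((ν i + 1 : ℝ) : ℂ) - (1 + r * ray)) = ν i - r * ray := fun i => by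
    push_cast; ring
  have key := norm_sq_sum_div_sub_le (fun i => ν i + 1) hμ (1 + r * ray)
    (fun i => by rw [e]; exact sub_mul_ray_ne_zero (hν i) r) s a
  simp_rw [e] at key
  have hS : ∑ k ∈ s, 2 * (ν k + 1) / ‖(ν k : ℂ) - r * ray‖ ^ 2 ≤ 8 * (1 + T) * T := by
    calc _ ≤ ∑ k ∈ s, 8 * (1 + T) * (1 / ν k) := by
          refine Finset.sum_le_sum fun k _ => ?_
          have hk := hν k
          have h1 : 1 / ν k ≤ T := hs.le_tsum k fun i _ => (one_div_pos.2 (hν i)).le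
          calc _ ≤ 2 * (ν k + 1) / (ν k / 2) ^ 2 := by
                gcongr
                exact half_le_norm_sub_mul_ray _ _
            _ = 8 * (1 + 1 / ν k) * (1 / ν k) := by field_simp; ring
            _ ≤ _ := by gcongr
      _ = 8 * (1 + T) * ∑ k ∈ s, 1 / ν k := by rw [Finset.mul_sum]
      _ ≤ _ := by
          gcongr
          exact hs.sum_le_tsum s fun i _ => (one_div_pos.2 (hν i)).le
  refine (abs_le_of_sq_le_sq' (key.trans ?_) (by positivity)).2
  calc _ ≤ M ^ 2 * (8 * (1 + T) * T) * (C * Real.exp (η * r)) ^ 2 := by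
        gcongr
        · exact Finset.sum_nonneg fun k _ => by have := hν k; positivity
        · exact gramForm_add_one_le s ν a hν hM
        · exact hprod s r hr
    _ = _ := by
        simp only [mul_pow]
        rw [Real.sq_sqrt (by positivity)]
        ring

/-- The modulus of equicontinuity for exponential sums on `(η, ∞)`: the distance of the kernels
`exp (-x w)` and `exp (-y w)` in the weighted `L¹` space of the ray. -/
noncomputable def rayDist (η x y : ℝ) : ℝ :=
  ∫ r in Ioi (0 : ℝ),
    ‖Complex.exp (-(r * x * ray)) - Complex.exp (-(r * y * ray))‖ * Real.exp (η * r)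

lemma exp_neg_mul_exp (η x r : ℝ) :
    Real.exp (-(r * x)) * Real.exp (η * r) = Real.exp (-(r * (x - η))) := by
  rw [← Real.exp_add]; congr 1; ring

lemma rayDist_integrand_le (η x y r : ℝ) :
    ‖Complex.exp (-(r * x * ray)) - Complex.exp (-(r * y * ray))‖ * Real.exp (η * r) ≤
      Real.exp (-(r * (x - η))) + Real.exp (-(r * (y - η))) := by
  rw [← exp_neg_mul_exp, ← exp_neg_mul_exp, ← add_mul]
  gcongr
  refine (norm_sub_le _ _).trans_eq ?_
  rw [norm_exp_neg_mul_ray, norm_exp_neg_mul_ray]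

lemma tendsto_rayDist {η y : ℝ} (hy : η < y) : Tendsto (fun x => rayDist η x y) (𝓝 y) (𝓝 0) := by
  have h : ContinuousAt (fun x => rayDist η x y) y := by
    refine continuousAt_of_dominated (bound := fun r => Real.exp (-(r * ((y - η) / 2))) +
      Real.exp (-(r * (y - η)))) (Eventually.of_forall fun x =>
        Continuous.aestronglyMeasurable (by fun_prop)) ?_ ?_ ?_
    · filter_upwards [Ioi_mem_nhds (show (y + η) / 2 < y by linarith)] with x hx
      filter_upwards [ae_restrict_mem measurableSet_Ioi] with r hr
      have hr : 0 < r := hr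
      have hx : (y + η) / 2 < x := hx
      rw [Real.norm_of_nonneg (by positivity)]
      refine (rayDist_integrand_le η x y r).trans ?_
      gcongr
      linarith
    · exact (integrableOn_exp_neg_mul (by linarith)).add (integrableOn_exp_neg_mul (by linarith))
    · exact ae_of_all _ fun r => by fun_prop
  have h0 : rayDist η y y = 0 := by simp [rayDist]
  simpa [ContinuousAt, h0] using h

/-- Bounded exponential sums with exponents `ν i` decay uniformly at infinity and are
equicontinuous on `(η, ∞)`. -/
lemma exists_abs_sum_exp_le {ν : ℕ → ℝ} (hν : ∀ i, 0 < ν i)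
    (hs : Summable fun i => 1 / ν i) {η : ℝ} (hη : 0 < η) :
    ∃ C > 0, ∀ (s : Finset ℕ) (a : ℕ → ℝ) (M : ℝ),
      (∀ x : ℝ, 0 < x → |∑ i ∈ s, a i * Real.exp (-(ν i * x))| ≤ M) →
        (∀ x : ℝ, η < x → |∑ i ∈ s, a i * Real.exp (-(ν i * x))| ≤ C * M * (1 / (x - η))) ∧
        ∀ x y : ℝ, η < x → η < y → |∑ i ∈ s, a i * Real.exp (-(ν i * x)) -
          ∑ i ∈ s, a i * Real.exp (-(ν i * y))| ≤ C * M * rayDist η x y := by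
  obtain ⟨C, hC, hbound⟩ := exists_norm_sum_div_sub_mul_ray_le hν hs hη
  obtain ⟨c, hc, him⟩ := exists_ne_zero_rayIntegral_im_eq
  refine ⟨|c|⁻¹ * (2 * C), by positivity, fun s a M hM => ?_⟩
  have hM0 : 0 ≤ M := (abs_nonneg _).trans (hM 1 one_pos)
  -- The Laplace transform at the points `-(r * ray)` of the ray.
  set G : ℝ → ℂ := fun r => ∑ i ∈ s, (a i : ℂ) / (ν i - r * ray) with hG
  have hint : ∀ x : ℝ, 0 < x →
      IntegrableOn (fun r : ℝ => Complex.exp (-(r * x * ray)) * (ray * G r))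
      (Ioi 0) ∧ ∑ i ∈ s, a i * Real.exp (-(ν i * x)) =
        c⁻¹ * (∫ r in Ioi (0 : ℝ), Complex.exp (-(r * x * ray)) * (ray * G r)).im := by
    intro x hx
    have e : (fun r : ℝ => Complex.exp (-(r * x * ray)) * (ray * G r)) = fun r : ℝ =>
        ∑ i ∈ s, (a i : ℂ) * (Complex.exp (-(r * x * ray)) * (ray / ((ν i : ℂ) - r * ray))) := by
      funext r
      rw [hG, Finset.mul_sum, Finset.mul_sum]
      exact Finset.sum_congr rfl fun i _ => by ring
    have hi : ∀ i ∈ s, IntegrableOn (fun r : ℝ => (a i : ℂ) * (Complex.exp (-(r * x * ray)) *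
        (ray / ((ν i : ℂ) - r * ray)))) (Ioi 0) :=
      fun i _ => (integrableOn_rayIntegrand (hν i) hx).const_mul _
    rw [e]
    refine ⟨integrable_finsetSum _ hi, ?_⟩
    rw [integral_finsetSum _ hi, Complex.im_sum, Finset.mul_sum]
    refine Finset.sum_congr rfl fun i _ => ?_
    rw [integral_const_mul, Complex.im_ofReal_mul]
    change _ = c⁻¹ * (a i * (rayIntegral (ν i) x).im)
    rw [him (ν i) (hν i) x hx]
    field_simp
  have hGb : ∀ r : ℝ, 0 < r → ‖ray * G r‖ ≤ 2 * C * M * Real.exp (η * r) := by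
    intro r hr
    rw [norm_mul]
    calc _ ≤ 2 * (C * M * Real.exp (η * r)) := by
          gcongr
          · exact norm_ray_le
          · exact hbound s a M hM r hr
      _ = _ := by ring
  constructor
  · intro x hx
    rw [(hint x (hη.trans hx)).2, abs_mul, abs_inv]
    have h1 : ‖∫ r in Ioi (0 : ℝ), Complex.exp (-(r * x * ray)) * (ray * G r)‖ ≤
        ∫ r in Ioi (0 : ℝ), Real.exp (-(r * (x - η))) * (2 * C * M) := by
      refine norm_integral_le_of_norm_le ((integrableOn_exp_neg_mul (by linarith)).mul_const _) ?_
      filter_upwards [ae_restrict_mem measurableSet_Ioi] with r hr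
      rw [norm_mul, norm_exp_neg_mul_ray, ← exp_neg_mul_exp]
      refine (mul_le_mul_of_nonneg_left (hGb r hr) (Real.exp_pos _).le).trans_eq (by ring)
    have h2 : ∫ r in Ioi (0 : ℝ), Real.exp (-(r * (x - η))) = 1 / (x - η) := by
      have h := integral_exp_mul_Ioi (a := -(x - η)) (by linarith) 0
      have e : ∀ r : ℝ, Real.exp (-(r * (x - η))) = Real.exp (-(x - η) * r) :=
        fun r => by congr 1; ring
      simp_rw [e, h]
      rw [mul_zero, Real.exp_zero, neg_div_neg_eq]
    rw [integral_mul_const, h2] at h1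
    calc _ ≤ |c|⁻¹ * (1 / (x - η) * (2 * C * M)) := by
          gcongr
          exact (Complex.abs_im_le_norm _).trans h1
      _ = _ := by ring
  · intro x y hx hy
    rw [(hint x (hη.trans hx)).2, (hint y (hη.trans hy)).2, ← mul_sub, ← Complex.sub_im,
      ← integral_sub (hint x (hη.trans hx)).1 (hint y (hη.trans hy)).1, abs_mul, abs_inv]
    have h1 : ‖∫ r in Ioi (0 : ℝ), (Complex.exp (-(r * x * ray)) * (ray * G r) -
        Complex.exp (-(r * y * ray)) * (ray * G r))‖ ≤
        ∫ r in Ioi (0 : ℝ), ‖Complex.exp (-(r * x * ray)) - Complex.exp (-(r * y * ray))‖ *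
          Real.exp (η * r) * (2 * C * M) := by
      refine norm_integral_le_of_norm_le (Integrable.mul_const ?_ _) ?_
      · refine ((integrableOn_exp_neg_mul (sub_pos.2 hx)).add
          (integrableOn_exp_neg_mul (sub_pos.2 hy))).mono'
          (Continuous.aestronglyMeasurable (by fun_prop)) (ae_of_all _ fun r => ?_)
        rw [Real.norm_of_nonneg (by positivity)]
        exact rayDist_integrand_le η x y r
      · filter_upwards [ae_restrict_mem measurableSet_Ioi] with r hr
        rw [← sub_mul, norm_mul]
        refine (mul_le_mul_of_nonneg_left (hGb r hr) (norm_nonneg _)).trans_eq (by ring)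
    rw [integral_mul_const] at h1
    calc _ ≤ |c|⁻¹ * (rayDist η x y * (2 * C * M)) := by
          gcongr
          exact (Complex.abs_im_le_norm _).trans h1
      _ = _ := by ring

/-! ### Equicontinuity in Müntz spaces and nets of points -/

lemma IsMuntzSequence.pos_succ {l : ℕ → ℝ≥0} (hl : IsMuntzSequence l) (i : ℕ) :
    (0 : ℝ) < l (i + 1) := by
  have := hl.strictMono i.succ_pos
  rw [hl.zero] at this
  exact_mod_cast this

lemma exists_eq_add_sum_of_mem_span {l : ℕ → ℝ≥0} (h0 : l 0 = 0) {f : C(unitInterval, ℝ)}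
    (hf : f ∈ Submodule.span ℝ (range fun i : ℕ => power (l i))) :
    ∃ (b : ℝ) (s : Finset ℕ) (a : ℕ → ℝ), ∀ t : unitInterval,
      f t = b + ∑ i ∈ s, a i * (t : ℝ) ^ (l (i + 1) : ℝ) := by
  obtain ⟨c, rfl⟩ := Finsupp.mem_span_range_iff_exists_finsupp.1 hf
  obtain ⟨N, hN⟩ := c.support.exists_nat_subset_range
  refine ⟨c 0, Finset.range N, fun i => c (i + 1), fun t => ?_⟩
  rw [Finsupp.sum_of_support_subset (s := Finset.range (N + 1)) c
    (hN.trans (Finset.range_mono N.le_succ)) _ (by simp), ContinuousMap.sum_apply,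
    Finset.sum_range_succ', add_comm]
  simp [power, h0]

/-- In the variable `x = -log t`, the function `f - f 0` is an exponential sum with positive
exponents, bounded by `2 ‖f‖`. -/
lemma exists_exp_sum_of_mem_span {l : ℕ → ℝ≥0} (hl : IsMuntzSequence l) {f : C(unitInterval, ℝ)}
    (hf : f ∈ Submodule.span ℝ (range fun i : ℕ => power (l i))) :
    ∃ (s : Finset ℕ) (a : ℕ → ℝ),
      (∀ t : unitInterval, 0 < (t : ℝ) → f t - f 0 =
        ∑ i ∈ s, a i * Real.exp (-((l (i + 1) : ℝ) * -Real.log t))) ∧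
      ∀ x : ℝ, 0 < x → |∑ i ∈ s, a i * Real.exp (-((l (i + 1) : ℝ) * x))| ≤ 2 * ‖f‖ := by
  have hpos := hl.pos_succ
  obtain ⟨b, s, a, h⟩ := exists_eq_add_sum_of_mem_span hl.zero hf
  have h0 : f 0 = b := by
    rw [h 0, Finset.sum_eq_zero, add_zero]
    intro i _
    rw [Icc.coe_zero, Real.zero_rpow (hpos i).ne', mul_zero]
  have key : ∀ t : unitInterval, 0 < (t : ℝ) → f t - f 0 =
      ∑ i ∈ s, a i * Real.exp (-((l (i + 1) : ℝ) * -Real.log t)) := by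
    intro t ht
    rw [h0, h t, add_sub_cancel_left]
    refine Finset.sum_congr rfl fun i _ => ?_
    rw [Real.rpow_def_of_pos ht]
    congr 2
    ring
  refine ⟨s, a, key, fun x hx => ?_⟩
  have hmem : Real.exp (-x) ∈ unitInterval :=
    ⟨(Real.exp_pos _).le, Real.exp_le_one_iff.2 (by linarith)⟩
  have h1 := key ⟨Real.exp (-x), hmem⟩ (Real.exp_pos _)
  simp only [Real.log_exp, neg_neg] at h1
  rw [← h1]
  have h2 := f.norm_coe_le_norm ⟨Real.exp (-x), hmem⟩
  have h3 := f.norm_coe_le_norm 0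
  rw [Real.norm_eq_abs] at h2 h3
  linarith [abs_sub (f ⟨Real.exp (-x), hmem⟩) (f 0)]

lemma abs_sub_le_of_forall_mem_span {l : ℕ → ℝ≥0} {s t : unitInterval} {ε : ℝ}
    (h : ∀ f ∈ Submodule.span ℝ (range fun i : ℕ => power (l i)), |f s - f t| ≤ ε * ‖f‖) :
    ∀ f ∈ muntzSpace l, |f s - f t| ≤ ε * ‖f‖ := by
  have hc : IsClosed {f : C(unitInterval, ℝ) | |f s - f t| ≤ ε * ‖f‖} :=
    isClosed_le (by fun_prop) (by fun_prop)
  exact fun f hf => closure_minimal h hc hf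

/-- The unit ball of the Müntz space is equicontinuous at every point `t < 1`. -/
lemma eventually_abs_sub_le {l : ℕ → ℝ≥0} (hl : IsMuntzSequence l) {t : unitInterval}
    (ht : (t : ℝ) < 1) {ε : ℝ} (hε : 0 < ε) :
    ∀ᶠ s in 𝓝 t, ∀ f ∈ muntzSpace l, |f s - f t| ≤ ε * ‖f‖ := by
  have hpos := hl.pos_succ
  rcases eq_or_lt_of_le t.2.1 with h0 | h0
  -- At `t = 0` the variable `-log s` tends to infinity, where exponential sums decay uniformly.
  · obtain rfl : t = 0 := Subtype.ext h0.symm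
    obtain ⟨C, hC, hb⟩ := exists_abs_sum_exp_le hpos hl.summable one_pos
    have hx0 : 0 < 2 * C / ε := by positivity
    have hev : ∀ᶠ s : unitInterval in 𝓝 0, (s : ℝ) < Real.exp (-(1 + 2 * C / ε)) :=
      continuous_subtype_val.continuousAt.eventually_lt continuousAt_const (Real.exp_pos _)
    filter_upwards [hev] with s hs
    refine abs_sub_le_of_forall_mem_span fun f hf => ?_
    rcases eq_or_lt_of_le s.2.1 with hs0 | hs0
    · obtain rfl : s = 0 := Subtype.ext hs0.symm
      simp; positivity
    obtain ⟨u, a, h1, h2⟩ := exists_exp_sum_of_mem_span hl hf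
    have hlog : 1 + 2 * C / ε < -Real.log s := by
      have := (Real.log_lt_iff_lt_exp hs0).2 hs
      linarith
    rw [h1 s hs0]
    refine ((hb u a _ h2).1 _ (by linarith)).trans ?_
    calc C * (2 * ‖f‖) * (1 / (-Real.log s - 1)) ≤ C * (2 * ‖f‖) * (1 / (2 * C / ε)) := by
          gcongr
          linarith
      _ = ε * ‖f‖ := by field_simp
  · have hy : 0 < -Real.log t := by linarith [Real.log_neg h0 ht]
    set y := -Real.log t with hydef
    obtain ⟨C, hC, hb⟩ := exists_abs_sum_exp_le hpos hl.summable (half_pos hy)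
    have hlog : Tendsto (fun s : unitInterval => -Real.log s) (𝓝 t) (𝓝 y) :=
      (continuous_subtype_val.continuousAt.log h0.ne').neg
    have hd : Tendsto (fun s : unitInterval => C * 2 * rayDist (y / 2) (-Real.log s) y) (𝓝 t)
        (𝓝 0) := by
      simpa using ((tendsto_rayDist (half_lt_self hy)).comp hlog).const_mul (C * 2)
    have hs0' : ∀ᶠ s : unitInterval in 𝓝 t, 0 < (s : ℝ) :=
      continuousAt_const.eventually_lt continuous_subtype_val.continuousAt h0
    filter_upwards [hs0', hlog.eventually_const_lt (half_lt_self hy), hd.eventually_lt_const hε]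
      with s hs0 hs1 hs2
    refine abs_sub_le_of_forall_mem_span fun f hf => ?_
    obtain ⟨u, a, h1, h2⟩ := exists_exp_sum_of_mem_span hl hf
    have e : f s - f t = (f s - f 0) - (f t - f 0) := by ring
    rw [e, h1 s hs0, h1 t h0]
    refine ((hb u a _ h2).2 _ _ hs1 (half_lt_self hy)).trans ?_
    calc C * (2 * ‖f‖) * rayDist (y / 2) (-Real.log s) y =
          C * 2 * rayDist (y / 2) (-Real.log s) y * ‖f‖ := by ring
      _ ≤ _ := by gcongr

/-- Finite subcovers of the compact pieces `[1 - 1 / (n + 1), 1 - 1 / (n + 2)]` of `[0, 1)` are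
put into one sequence, which tends to `1` because only finitely many of its points lie below any
`b < 1`. -/
lemma exists_seq_tendsto_one {U : unitInterval → Set unitInterval}
    (hU : ∀ t : unitInterval, (t : ℝ) < 1 → U t ∈ 𝓝 t) :
    ∃ s : ℕ → unitInterval, Tendsto s atTop (𝓝 1) ∧
      ∀ t : unitInterval, (t : ℝ) < 1 → ∃ n, t ∈ U (s n) := by
  classical
  set v : ℕ → ℝ := fun n => 1 - 1 / ((n : ℝ) + 1) with hv
  have hv1 : ∀ n, v n < 1 := fun n => by
    have : (0 : ℝ) < 1 / ((n : ℝ) + 1) := by positivity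
    simp only [hv]; linarith
  have hvt : Tendsto v atTop (𝓝 1) := by
    simpa [hv] using (tendsto_one_div_add_atTop_nhds_zero_nat (𝕜 := ℝ)).const_sub 1
  have hv0 : v 0 = 0 := by simp [hv]
  have hK : ∀ n, ∃ F : Finset unitInterval,
      (∀ x ∈ F, x ∈ {t : unitInterval | v n ≤ t ∧ (t : ℝ) ≤ v (n + 1)}) ∧
      {t : unitInterval | v n ≤ t ∧ (t : ℝ) ≤ v (n + 1)} ⊆ ⋃ x ∈ F, U x := by
    intro n
    refine IsCompact.elim_nhds_subcover (IsClosed.isCompact ?_) U fun x hx =>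
      hU x (hx.2.trans_lt (hv1 _))
    exact (isClosed_le continuous_const continuous_subtype_val).inter
      (isClosed_le continuous_subtype_val continuous_const)
  choose F hF hcov using hK
  let _ : Encodable (Σ n, F n) := Encodable.ofCountable _
  -- Indices that encode no chosen point carry the value `1`, the limit of the sequence.
  set s : ℕ → unitInterval := fun m =>
    (Encodable.decode₂ (Σ n, F n) m).elim 1 fun p => p.2 with hs
  refine ⟨s, ?_, fun t ht => ?_⟩
  · rw [tendsto_subtype_rng]
    refine tendsto_order.2 ⟨fun b hb => ?_, fun b hb => Eventually.of_forall fun m =>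
      (s m).2.2.trans_lt hb⟩
    obtain ⟨N, hN⟩ := (eventually_atTop.1 (hvt.eventually_const_lt hb))
    rw [← Nat.cofinite_eq_atTop, eventually_cofinite]
    refine Finite.subset (s := ⋃ n ∈ Finset.range N, ⋃ x : F n,
      {Encodable.encode (⟨n, x⟩ : Σ n, F n)}) ?_ ?_
    · exact Finite.biUnion (Finset.finite_toSet _) fun n _ =>
        finite_iUnion fun x => finite_singleton _
    · intro m hm
      simp only [mem_ofPred_eq, not_lt, hs] at hm
      rcases hd : Encodable.decode₂ (Σ n, F n) m with _ | ⟨n, x⟩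
      · rw [hd] at hm
        exact absurd hm (not_le.2 hb)
      · rw [hd] at hm
        have hm : ((x : unitInterval) : ℝ) ≤ b := hm
        have hnN : n < N := by
          by_contra! hc
          exact absurd ((hN n hc).trans_le ((hF n x x.2).1.trans hm)) (lt_irrefl _)
        simp only [mem_iUnion, Finset.mem_range, mem_singleton_iff]
        exact ⟨n, hnN, x, (Encodable.decode₂_eq_some.1 hd).symm⟩
  · have hex : ∃ n, (t : ℝ) ≤ v (n + 1) := by
      obtain ⟨n, hn⟩ := (((tendsto_add_atTop_iff_nat 1).2 hvt).eventually_const_lt ht).exists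
      exact ⟨n, hn.le⟩
    have hn := Nat.find_spec hex
    have hn' : v (Nat.find hex) ≤ t := by
      rcases hk : Nat.find hex with _ | k
      · rw [hv0]; exact t.2.1
      · exact (not_le.1 (Nat.find_min hex (hk ▸ k.lt_succ_self))).le
    obtain ⟨x, hx, htx⟩ := mem_iUnion₂.1 (hcov _ ⟨hn', hn⟩)
    refine ⟨Encodable.encode (⟨_, ⟨x, hx⟩⟩ : Σ n, F n), ?_⟩
    simpa only [hs, Encodable.encodek₂, Option.elim] using htx

/-! ### The embedding into convergent sequences -/

/-- Evaluation of continuous functions at the points of a sequence tending to `1`, as a linear map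
to the space of convergent sequences. -/
noncomputable def evalSeqₗ (s : ℕ → unitInterval) (hs : Tendsto s atTop (𝓝 1)) :
    C(unitInterval, ℝ) →ₗ[ℝ] convergentSeq where
  toFun f := ⟨(BoundedContinuousFunction.mkOfCompact f).compContinuous
    ⟨s, continuous_of_discreteTopology⟩, f 1, (f.continuous.tendsto 1).comp hs⟩
  map_add' _ _ := rfl
  map_smul' _ _ := rfl

lemma norm_evalSeqₗ_le (s : ℕ → unitInterval) (hs : Tendsto s atTop (𝓝 1))
    (f : C(unitInterval, ℝ)) : ‖evalSeqₗ s hs f‖ ≤ ‖f‖ :=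
  (BoundedContinuousFunction.norm_le (norm_nonneg f)).2 fun n => f.norm_coe_le_norm (s n)

/-- `evalSeqₗ` as a bounded operator. -/
noncomputable def evalSeq (s : ℕ → unitInterval) (hs : Tendsto s atTop (𝓝 1)) :
    C(unitInterval, ℝ) →L[ℝ] convergentSeq :=
  ⟨evalSeqₗ s hs, AddMonoidHomClass.continuous_of_bound (evalSeqₗ s hs) 1 fun f => by
    simpa using norm_evalSeqₗ_le s hs f⟩

lemma abs_le_norm_evalSeq (s : ℕ → unitInterval) (hs : Tendsto s atTop (𝓝 1))
    (f : C(unitInterval, ℝ)) (n : ℕ) : |f (s n)| ≤ ‖evalSeq s hs f‖ :=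
  (evalSeqₗ s hs f : ℕ →ᵇ ℝ).norm_coe_le_norm n

lemma le_norm_evalSeq {s : ℕ → unitInterval} (hs : Tendsto s atTop (𝓝 1)) {ε : ℝ} (hε : 0 ≤ ε)
    {f : C(unitInterval, ℝ)}
    (h : ∀ t : unitInterval, (t : ℝ) < 1 → ∃ n, |f t - f (s n)| ≤ ε * ‖f‖) :
    (1 - ε) * ‖f‖ ≤ ‖evalSeq s hs f‖ := by
  suffices ‖f‖ ≤ ‖evalSeq s hs f‖ + ε * ‖f‖ by linarith
  refine (f.norm_le (by positivity)).2 fun t => ?_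
  rw [Real.norm_eq_abs]
  rcases lt_or_eq_of_le t.2.2 with ht | ht
  · obtain ⟨n, hn⟩ := h t ht
    have h1 := abs_le_norm_evalSeq s hs f n
    have h2 := abs_sub_abs_le_abs_sub (f t) (f (s n))
    linarith
  · obtain rfl : t = 1 := Subtype.ext ht
    have h1 : |f 1| ≤ ‖evalSeq s hs f‖ :=
      le_of_tendsto ((f.continuous.tendsto 1).comp hs).abs
        (Eventually.of_forall fun n => abs_le_norm_evalSeq s hs f n)
    have : 0 ≤ ε * ‖f‖ := by positivity
    linarith

/-- Every subspace of a Müntz space, the whole space included, is almost isometric to a subspace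
of `c`. -/
lemma almostIsometricToSubspace_muntzSpace {l : ℕ → ℝ≥0} (hl : IsMuntzSequence l)
    (Y : Submodule ℝ (muntzSpace l)) : AlmostIsometricToSubspace Y convergentSeq := by
  intro ε hε
  obtain ⟨s, hs, hcov⟩ := exists_seq_tendsto_one
    (U := fun t => {s | ∀ f ∈ muntzSpace l, |f s - f t| ≤ ε * ‖f‖})
    fun t ht => eventually_abs_sub_le hl ht hε
  refine ⟨(evalSeq s hs).comp ((muntzSpace l).subtypeL.comp Y.subtypeL), fun f =>
    ⟨le_norm_evalSeq hs hε.le fun t ht => ?_, norm_evalSeqₗ_le s hs _⟩⟩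
  obtain ⟨n, hn⟩ := hcov t ht
  exact ⟨n, hn _ (f : muntzSpace l).2⟩

end Muntz

theorem mainTheorem1 (l : ℕ → ℝ≥0) (hl : Muntz.IsMuntzSequence l) :
    ∃ X Y : Submodule ℝ (Muntz.muntzSpace l),
      Submodule.IsTopCompl X Y ∧ FiniteDimensional ℝ X ∧
        Muntz.AlmostIsometricToSubspace Y Muntz.convergentSeq :=
  ⟨⊥, ⊤, Submodule.isTopCompl_bot_top, inferInstance,
    Muntz.almostIsometricToSubspace_muntzSpace hl ⊤⟩
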